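/- Let $\mathfrak{M}$ be an arbitrary $W^*$-algebra (a $C^*$-algebra that is isometrically the dual of a Banach space), equipped with its norm topology, and let $a\in\mathfrak{M}$ be normal. Denote by $p_a$ the range projection of $a$, i.e. the smallest projection $p\in\mathfrak{M}$ with $pa=a$, and put $$\mathcal{V}_a=\{v\in\mathfrak{M} : v^*v=p_a\},\qquad \mathcal{O}_a=\{vav^* : v\in\mathcal{V}_a\},\qquad \mathcal{O}(b)=\{ubu^* : u\in\mathfrak{M}\text{ unitary}\}\quad(b\in\mathfrak{M}).$$ Suppose that the spectrum of $a$ is a finite set. Then there is a family $(\nu_i)_{i\in I}$ of elements of $\mathcal{V}_a$ such that, with $a_i=\nu_i a\nu_i^*$: (i) $\mathcal{O}_a$ is the disjoint union of the unitary orbits $\mathcal{O}(a_i)$, $i\in I$; (ii) the sets $\mathcal{O}(a_i)$ are exactly the connected components of $\mathcal{O}_a$; (iii) every $\mathcal{O}(a_i)$ is open and closed in $\mathcal{O}_a$. In particular, $\mathcal{O}_a$ is a closed subset and an embedded split smooth submanifold of the real Banach space $\mathfrak{M}$: around every $x\in\mathcal{O}_a$ there is a $C^\infty$ diffeomorphism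 $\varphi\colon V\to W$ between open subsets of $\mathfrak{M}$, $x\in V$, and a closed real linear subspace $T\subseteq\mathfrak{M}$ having a closed complement, such that $\varphi(V\cap\mathcal{O}_a)=W\cap T$. (The space $T$ may depend on $x$.) -/

import Mathlib

open scoped ContDiff

namespace GroupoidOrbit

section Algebra

variable {M : Type*} [CStarAlgebra M]

/-- `p` is the range projection `p_a` of `a`: the smallest projection `p` with `p a = a`, where
projections carry their usual order (`p ≤ q` iff `q p = p`). Such a `p` is unique. -/
def IsRangeProjection (a p : M) : Prop :=
  IsStarProjection p ∧ p * a = a ∧ ∀ q : M, IsStarProjection q → q * a = a → q * p = p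

variable (M) in
/-- The partial isometries of `M`: those `v` for which `v* v` is a projection. -/
def partialIsometries : Set M :=
  {v | IsStarProjection (star v * v)}

/-- `V_a`: the partial isometries `v` with `v* v = p_a`, i.e. those for which `(v, a)` is an arrow
of the action groupoid of the partial isometries on the normal elements. -/
def sourceFiber (a : M) : Set M :=
  {v | v ∈ partialIsometries M ∧ IsRangeProjection a (star v * v)}

/-- The groupoid orbit `O_a = {v a v* | v ∈ V_a}`. -/
def groupoidOrbit (a : M) : Set M :=
  {b | ∃ v ∈ sourceFiber a, b = v * a * star v}

/-- The unitary orbit `O(a) = {u a u* | u unitary in M}`. -/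
def unitaryOrbit (a : M) : Set M :=
  {b | ∃ u ∈ unitary M, b = u * a * star u}

end Algebra

/-- `S` is an embedded split (smooth) submanifold of the real Banach space `X`: around each of its
points, some diffeomorphism `φ` between open subsets of `X` straightens `S` to (the trace of) a
closed linear subspace `T` that has a closed complement. The subspace `T` may vary with the point,
so different connected components may have non-isomorphic model spaces. -/
def IsEmbeddedSplitSubmanifold {X : Type*} [NormedAddCommGroup X] [NormedSpace ℝ X]
    (S : Set X) : Prop :=
  ∀ x ∈ S, ∃ (T : Submodule ℝ X) (φ : OpenPartialHomeomorph X X),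
    T.ClosedComplemented ∧ x ∈ φ.source ∧
    ContDiffOn ℝ ∞ φ φ.source ∧ ContDiffOn ℝ ∞ φ.symm φ.target ∧
    φ '' (φ.source ∩ S) = φ.target ∩ (T : Set X)

end GroupoidOrbit

namespace GroupoidOrbit

/-! All elements of O_a are normal and annihilated by one polynomial with simple roots, namely the
spectrum together with 0; the set `normalZeros` of such elements is closed. If x and b in it are
close, then z = Σ e_t(x) e_t(b), with e_t the spectral projections, is near 1 and satisfies xz = zb;
its unitary polar part u then satisfies xu = ub. So unitary orbits are relatively open in
`normalZeros`, which makes them clopen in O_a and makes O_a closed. Since z is polynomial in x, the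
map x ↦ u b u* is defined and smooth at all x near b (`exists_retraction_unitaryOrbit`): O_a is
locally a smooth retract, hence a split submanifold.

Orbits are connected because the unitary group is (`joined_one_unitary`): every unitary is a product
of two unitaries at distance less than 2 from 1. The factors come from a projection separating the
signs of Im u, a supremum of continuous functions of Im u that exists by weak* compactness of balls.
-/

open Filter Topology Polynomial

/-! ### Suprema of monotone sequences from weak* compactness. -/

section WStar

variable {M : Type*} [CStarAlgebra M]

/-- In a `W⋆`-algebra every bounded sequence has a point lying in all closed balls which eventually
contain the sequence. -/
lemma exists_mem_closedBall_of_eventually [WStarAlgebra M] (x : ℕ → M) (R : ℝ)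
    (hx : ∀ n, ‖x n‖ ≤ R) :
    ∃ y : M, ∀ (c : M) (r : ℝ), (∀ᶠ n in atTop, ‖x n - c‖ ≤ r) → ‖y - c‖ ≤ r := by
  obtain ⟨X, _, _, _, ⟨e⟩⟩ := WStarAlgebra.exists_predual (M := M)
  let U : Ultrafilter ℕ := Ultrafilter.of atTop
  let F : ℕ → WeakDual ℂ X := fun n => StrongDual.toWeakDual (e.symm (x n))
  have hball : ∀ (c : M) (r : ℝ) (n : ℕ), ‖x n - c‖ ≤ r →
      F n ∈ WeakDual.toStrongDual ⁻¹' Metric.closedBall (e.symm c) r := by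
    intro c r n h
    simpa [F, Metric.mem_closedBall, dist_eq_norm, ← map_sub] using h
  -- Banach–Alaoglu gives an ultrafilter limit; closed balls are weak* closed, so it inherits all
  -- eventual ball conditions.
  obtain ⟨f, -, hf⟩ :=
    (WeakDual.isCompact_closedBall (𝕜 := ℂ) (E := X) (e.symm 0) R).ultrafilter_le_nhds (U.map F) (by
      rw [le_principal_iff]
      exact (Ultrafilter.mem_map.2 (Filter.Eventually.of_forall fun n => hball 0 R n (by simpa using hx n))))
  refine ⟨e (WeakDual.toStrongDual f), fun c r h => ?_⟩
  have hmem : f ∈ WeakDual.toStrongDual ⁻¹' Metric.closedBall (e.symm c) r := by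
    refine (WeakDual.isClosed_closedBall _ _).mem_of_tendsto (b := (U : Filter ℕ)) (f := F) hf ?_
    exact (h.filter_mono (Ultrafilter.of_le _)).mono fun n hn => hball c r n hn
  have h2 : ‖WeakDual.toStrongDual f - e.symm c‖ ≤ r := by
    simpa [Metric.mem_closedBall, dist_eq_norm] using hmem
  rw [← e.norm_map] at h2
  simpa using h2

/-- A spectral value μ ≠ 0 of Im y would give (μ + t)² ≤ R² + t² for all t, which the linear term
2μt violates. -/
lemma isSelfAdjoint_of_norm_add_smul_I_le {y : M} {R : ℝ}
    (h : ∀ t : ℝ, ‖y + algebraMap ℂ M (t * Complex.I)‖ ^ 2 ≤ R ^ 2 + t ^ 2) :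
    IsSelfAdjoint y := by
  rcases subsingleton_or_nontrivial M with hM | hM
  · exact Subsingleton.elim _ _
  set k : M := (imaginaryPart y : M) with hk
  have hksa : IsSelfAdjoint k := (imaginaryPart y).2
  have hbound : ∀ μ ∈ spectrum ℝ k, ∀ t : ℝ, (μ + t) ^ 2 ≤ R ^ 2 + t ^ 2 := by
    intro μ hμ t
    have h1 : t + μ ∈ spectrum ℝ (algebraMap ℝ M t + k) := by
      rw [add_comm (algebraMap ℝ M t) k, add_comm t μ]
      exact (spectrum.add_singleton_eq (R := ℝ) k t) ▸ Set.add_mem_add hμ rfl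
    have h2 : algebraMap ℝ M t + k =
        (imaginaryPart (y + algebraMap ℂ M (t * Complex.I)) : M) := by
      have : imaginaryPart (algebraMap ℂ M (t * Complex.I)) =
          t • (1 : selfAdjoint M) := by
        ext
        simp [Algebra.algebraMap_eq_smul_one, imaginaryPart_smul]
      rw [map_add, this]
      simp [hk, Algebra.algebraMap_eq_smul_one, add_comm]
    have h3 : |t + μ| ≤ ‖y + algebraMap ℂ M (t * Complex.I)‖ := by
      calc |t + μ| ≤ ‖algebraMap ℝ M t + k‖ := spectrum.norm_le_norm_of_mem h1
        _ ≤ _ := by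
          rw [h2]
          exact imaginaryPart.norm_le (y + algebraMap ℂ M (t * Complex.I))
    calc (μ + t) ^ 2 = |t + μ| ^ 2 := by rw [sq_abs, add_comm]
      _ ≤ _ := by gcongr
      _ ≤ _ := h t
  have hzero : ∀ μ ∈ spectrum ℝ k, μ = 0 := by
    intro μ hμ
    by_contra hne
    have := hbound μ hμ ((R ^ 2 + 1) / (2 * μ))
    have h4 : 2 * μ * ((R ^ 2 + 1) / (2 * μ)) = R ^ 2 + 1 := by field_simp
    nlinarith [sq_nonneg μ]
  have hk0 : k = 0 := by
    rw [← norm_eq_zero]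
    rcases CStarAlgebra.norm_or_neg_norm_mem_spectrum hksa with h1 | h1
    · exact hzero _ h1
    · exact neg_eq_zero.1 (hzero _ h1)
  have := realPart_add_I_smul_imaginaryPart y
  rw [← hk, hk0, smul_zero, add_zero] at this
  rw [← this]
  exact (realPart y).2

lemma norm_add_smul_I_le {y : M} {R : ℝ} (hy : IsSelfAdjoint y) (hR : ‖y‖ ≤ R) (t : ℝ) :
    ‖y + algebraMap ℂ M (t * Complex.I)‖ ^ 2 ≤ R ^ 2 + t ^ 2 := by
  rw [sq, ← CStarRing.norm_star_mul_self]
  have : star (y + algebraMap ℂ M (t * Complex.I)) * (y + algebraMap ℂ M (t * Complex.I))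
      = y * y + algebraMap ℂ M ((t : ℂ) ^ 2) := by
    rw [star_add, hy.star_eq, ← algebraMap_star_comm]
    simp only [add_mul, mul_add, ← map_mul]
    have : y * algebraMap ℂ M (t * Complex.I) = algebraMap ℂ M (t * Complex.I) * y :=
      (Algebra.commutes _ _).symm
    rw [this]
    have h3 : star ((t : ℂ) * Complex.I) = - (t * Complex.I) := by simp
    have h4 : -(↑t * Complex.I) * (↑t * Complex.I) = (t : ℂ)^2 := by
      linear_combination (-(t : ℂ)^2) * Complex.I_mul_I
    rw [h3, h4, map_neg]
    noncomm_ring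
  rw [this]
  rcases subsingleton_or_nontrivial M with hM | hM
  · rw [Subsingleton.elim (y * y + _) 0, norm_zero]; positivity
  calc _ ≤ ‖y * y‖ + ‖algebraMap ℂ M ((t : ℂ) ^ 2)‖ := norm_add_le _ _
    _ ≤ R ^ 2 + t ^ 2 := by
      gcongr
      · calc _ ≤ ‖y‖ * ‖y‖ := norm_mul_le _ _
          _ ≤ R ^ 2 := by nlinarith [norm_nonneg y]
      · rw [norm_algebraMap']; simp

variable [PartialOrder M] [StarOrderedRing M]

/-- An order interval is an intersection of closed balls, so it survives the passage to the limit
point of `exists_mem_closedBall_of_eventually`. -/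
lemma mem_Icc_iff_norm_le {y : M} {R : ℝ} (hR : 0 ≤ R) :
    y ∈ Set.Icc 0 (algebraMap ℝ M R) ↔
      (∀ t : ℝ, ‖y + algebraMap ℂ M (t * Complex.I)‖ ^ 2 ≤ R ^ 2 + t ^ 2) ∧
      ‖algebraMap ℝ M R - y‖ ≤ R := by
  constructor
  · intro hy
    have h1 := (CStarAlgebra.mem_Icc_algebraMap_iff_norm_le hR).1 hy
    refine ⟨norm_add_smul_I_le (.of_nonneg h1.1) h1.2, ?_⟩
    exact (CStarAlgebra.norm_le_iff_le_algebraMap _ hR (sub_nonneg.2 hy.2)).2 (sub_le_self _ hy.1)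
  · rintro ⟨h1, h2⟩
    have hsa := isSelfAdjoint_of_norm_add_smul_I_le h1
    have hn : ‖y‖ ≤ R := abs_le_of_sq_le_sq' (by simpa using h1 0) hR |>.2
    refine ⟨?_, hsa.le_algebraMap_norm_self.trans (algebraMap_mono M hn)⟩
    have hsa' : IsSelfAdjoint (algebraMap ℝ M R - y) :=
      (IsSelfAdjoint.algebraMap M (.all R)).sub hsa
    have := hsa'.le_algebraMap_norm_self.trans (algebraMap_mono M h2)
    simpa using this

/-- In a `W⋆`-algebra monotone sequences in the operator interval `[0, 1]` have suprema. -/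
lemma exists_isLUB_of_monotone [WStarAlgebra M] {x : ℕ → M} (hx : Monotone x)
    (h0 : ∀ n, 0 ≤ x n) (h1 : ∀ n, x n ≤ 1) : ∃ p, IsLUB (Set.range x) p := by
  obtain ⟨p, hp⟩ := exists_mem_closedBall_of_eventually x 1 fun n =>
    (CStarAlgebra.norm_le_one_iff_of_nonneg _ (h0 n)).2 (h1 n)
  have hlow : ∀ (R : ℝ) (_ : 0 ≤ R) (c : M), (∀ᶠ n in atTop, x n - c ∈ Set.Icc 0 (algebraMap ℝ M R)) →
      p - c ∈ Set.Icc 0 (algebraMap ℝ M R) := by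
    intro R hR c h
    simp only [mem_Icc_iff_norm_le hR] at h ⊢
    refine ⟨fun t => ?_, ?_⟩
    · have := hp (c - algebraMap ℂ M (t * Complex.I)) (√(R ^ 2 + t ^ 2)) (h.mono fun n hn => ?_)
      · rw [← Real.le_sqrt (norm_nonneg _)]
        · simpa [sub_sub_eq_add_sub, add_sub_right_comm] using this
        · positivity
      · refine Real.le_sqrt_of_sq_le ?_
        simpa [sub_sub_eq_add_sub, add_sub_right_comm] using hn.1 t
    · have := hp (c + algebraMap ℝ M R) R (h.mono fun n hn => ?_)
      · rw [norm_sub_rev]; simpa [sub_sub] using this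
      · have := hn.2
        rw [norm_sub_rev] at this; simpa [sub_sub] using this
  refine ⟨p, ?_, ?_⟩
  · rintro _ ⟨m, rfl⟩
    refine sub_nonneg.1 (hlow 1 zero_le_one (x m) ?_).1
    filter_upwards [eventually_ge_atTop m] with n hn
    refine ⟨sub_nonneg.2 (hx hn), ?_⟩
    rw [map_one]
    exact (sub_le_self _ (h0 m)).trans (h1 n)
  · intro z hz
    have hz0 : 0 ≤ z := (h0 0).trans (hz ⟨0, rfl⟩)
    have hzR : z ≤ algebraMap ℝ M ‖z‖ := IsSelfAdjoint.le_algebraMap_norm_self (.of_nonneg hz0)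
    -- The shift by z - ‖z‖ turns x n ≤ z into membership of an interval [0, ‖z‖].
    have := (hlow ‖z‖ (norm_nonneg _) (z - algebraMap ℝ M ‖z‖) (.of_forall fun n => ?_)).2
    · rw [sub_sub_eq_add_sub, sub_le_iff_le_add, add_comm (algebraMap ℝ M ‖z‖)] at this
      exact le_of_add_le_add_right this
    · constructor
      · rw [sub_nonneg]
        exact (sub_nonpos.2 hzR).trans (h0 n)
      · rw [sub_sub_eq_add_sub, sub_le_iff_le_add, add_comm (algebraMap ℝ M ‖z‖)]
        exact add_le_add_left (hz ⟨n, rfl⟩) _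

end WStar

/-! ### Projections separating positive and negative parts. -/

section Sign

variable {M : Type*} [CStarAlgebra M]

/-- Continuous functions increasing to the indicator function of the positive half line. -/
noncomputable def approxPos (n : ℕ) (t : ℝ) : ℝ :=
  (n + 1) * max t 0 / (1 + (n + 1) * max t 0)

lemma one_add_mul_max_pos (n : ℕ) (t : ℝ) : 0 < 1 + ((n : ℝ) + 1) * max t 0 := by
  have : 0 ≤ max t 0 := le_max_right _ _
  positivity

@[fun_prop]
lemma continuous_approxPos (n : ℕ) : Continuous (approxPos n) := by
  unfold approxPos
  exact Continuous.div (by fun_prop) (by fun_prop) fun t => (one_add_mul_max_pos n t).ne'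

lemma approxPos_nonneg (n : ℕ) (t : ℝ) : 0 ≤ approxPos n t := by
  have : 0 ≤ max t 0 := le_max_right _ _
  unfold approxPos; positivity

lemma approxPos_le_one (n : ℕ) (t : ℝ) : approxPos n t ≤ 1 := by
  unfold approxPos
  rw [div_le_one (one_add_mul_max_pos n t)]
  linarith

lemma approxPos_mono (t : ℝ) : Monotone fun n => approxPos n t := by
  intro m n h
  have h0 : 0 ≤ max t 0 := le_max_right _ _
  have h' : (m : ℝ) ≤ n := by exact_mod_cast h
  simp only [approxPos]
  rw [div_le_div_iff₀ (one_add_mul_max_pos m t) (one_add_mul_max_pos n t)]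
  nlinarith [mul_le_mul_of_nonneg_right h' h0]

lemma approxPos_of_nonpos (n : ℕ) {t : ℝ} (ht : t ≤ 0) : approxPos n t = 0 := by
  simp [approxPos, max_eq_right ht]

lemma approxPos_add_approxPos_neg_le_one (m n : ℕ) (t : ℝ) :
    approxPos m t + approxPos n (-t) ≤ 1 := by
  rcases le_total t 0 with h | h
  · rw [approxPos_of_nonpos m h, zero_add]; exact approxPos_le_one _ _
  · rw [approxPos_of_nonpos n (neg_nonpos.2 h), add_zero]; exact approxPos_le_one _ _

variable [PartialOrder M] [StarOrderedRing M]

lemma mul_eq_zero_of_conjugate_eq_zero {q c : M} (hq : 0 ≤ q) (h : star c * q * c = 0) :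
    q * c = 0 := by
  have h1 : CFC.sqrt q * c = 0 := by
    rw [← CStarRing.star_mul_self_eq_zero_iff, star_mul, (IsSelfAdjoint.of_nonneg (CFC.sqrt_nonneg q)).star_eq]
    rw [← h]
    nth_rw 3 [← CFC.sqrt_mul_sqrt_self q hq]
    noncomm_ring
  rw [← CFC.sqrt_mul_sqrt_self q hq, mul_assoc, h1, mul_zero]

/-- With c = √(s₊), c(1 - q)c is dominated by c(1 - fₙ(s))c, whose norm is at most sup τ/(1 +
(n+1)τ) ≤ 1/(n+1). Hence (1 - q)c = 0. -/
lemma mul_cfc_max_zero_of_approxPos_le {s q : M} (hs : IsSelfAdjoint s)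
    (h : ∀ n, cfc (approxPos n) s ≤ q) (hq : q ≤ 1) :
    q * cfc (fun t : ℝ => max t 0) s = cfc (fun t : ℝ => max t 0) s := by
  set c : M := cfc (fun t : ℝ => √(max t 0)) s with hc
  have hcsa : IsSelfAdjoint c := cfc_predicate _ _
  have hbound : ∀ n : ℕ, ‖c * (1 - q) * c‖ ≤ 1 / (n + 1) := by
    intro n
    have h1 : c * (1 - q) * c ≤ c * (1 - cfc (approxPos n) s) * c :=
      hcsa.conjugate_le_conjugate (sub_le_sub_left (h n) 1)
    have h2 : c * (1 - cfc (approxPos n) s) * c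
        = cfc (fun t => √(max t 0) * (1 - approxPos n t) * √(max t 0)) s := by
      rw [cfc_mul .., cfc_mul .., cfc_sub .., cfc_const_one ℝ s]
    refine (CStarAlgebra.norm_le_norm_of_nonneg_of_le
      (hcsa.conjugate_nonneg (sub_nonneg.2 hq)) h1).trans ?_
    rw [h2]
    refine norm_cfc_le (by positivity) fun t _ => ?_
    have h0 : 0 ≤ max t 0 := le_max_right _ _
    have h3 : √(max t 0) * (1 - approxPos n t) * √(max t 0) =
        max t 0 / (1 + (n + 1) * max t 0) := by
      rw [mul_right_comm, Real.mul_self_sqrt h0, approxPos]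
      have := (one_add_mul_max_pos n t).ne'
      field_simp
      ring
    rw [h3, Real.norm_of_nonneg (by positivity), div_le_div_iff₀ (one_add_mul_max_pos n t) (by positivity)]
    nlinarith
  have hz : c * (1 - q) * c = 0 := by
    rw [← norm_le_zero_iff]
    exact ge_of_tendsto' tendsto_one_div_add_atTop_nhds_zero_nat hbound
  have h4 : (1 - q) * c = 0 :=
    mul_eq_zero_of_conjugate_eq_zero (sub_nonneg.2 hq) (by rwa [hcsa.star_eq])
  have h5 : cfc (fun t : ℝ => max t 0) s = c * c := by
    rw [hc, ← cfc_mul ..]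
    refine cfc_congr fun t _ => ?_
    exact (Real.mul_self_sqrt (le_max_right _ _)).symm
  rw [sub_mul, one_mul, sub_eq_zero] at h4
  rw [h5, ← mul_assoc, ← h4]

lemma sq_le_self_of_nonneg_of_le_one {p : M} (h0 : 0 ≤ p) (h1 : p ≤ 1) : p * p ≤ p := by
  have h := (IsSelfAdjoint.of_nonneg (CFC.sqrt_nonneg p)).conjugate_le_conjugate h1
  have hs := CFC.sqrt_mul_sqrt_self p h0
  rw [mul_one, hs] at h
  have h2 : CFC.sqrt p * p * CFC.sqrt p = p * p := by
    calc _ = CFC.sqrt p * (CFC.sqrt p * CFC.sqrt p) * CFC.sqrt p := by rw [hs]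
      _ = (CFC.sqrt p * CFC.sqrt p) * (CFC.sqrt p * CFC.sqrt p) := by simp only [mul_assoc]
      _ = p * p := by rw [hs]
  rwa [h2] at h

/-- In a `W⋆`-algebra, a unitary commutes with a projection which separates the positive part of a
commuting selfadjoint element from its negative part. -/
lemma exists_isStarProjection_posPart [WStarAlgebra M] {s u : M} (hs : IsSelfAdjoint s)
    (hu : u ∈ unitary M) (hsu : Commute s u) :
    ∃ p : M, IsStarProjection p ∧ Commute p u ∧
      p * cfc (fun t : ℝ => max t 0) s = cfc (fun t : ℝ => max t 0) s ∧
      p * cfc (fun t : ℝ => max (-t) 0) s = 0 := by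
  obtain ⟨p, hp⟩ := exists_isLUB_of_monotone (x := fun n => cfc (approxPos n) s)
    (fun m n h => cfc_mono fun t _ => approxPos_mono t h)
    (fun n => cfc_nonneg fun t _ => approxPos_nonneg n t)
    (fun n => cfc_le_one _ _ fun t _ => approxPos_le_one n t)
  have hle : ∀ n, cfc (approxPos n) s ≤ p := fun n => hp.1 ⟨n, rfl⟩
  have hp1 : p ≤ 1 := hp.2 (by
    rintro _ ⟨n, rfl⟩
    exact cfc_le_one _ _ fun t _ => approxPos_le_one n t)
  have hp0 : 0 ≤ p := (cfc_nonneg fun t _ => approxPos_nonneg 0 t).trans (hle 0)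
  have hpsa : IsSelfAdjoint p := .of_nonneg hp0
  have hpos := mul_cfc_max_zero_of_approxPos_le hs hle hp1
  have hneg : p * cfc (fun t : ℝ => max (-t) 0) s = 0 := by
    -- Since fₘ(s) + fₙ(-s) ≤ 1, each 1 - fₙ(-s) is an upper bound of the fₘ(s), so 1 - p dominates
    -- fₙ(-s).
    have h1 := mul_cfc_max_zero_of_approxPos_le (s := -s) (q := 1 - p) hs.neg (fun n => ?_)
      (sub_le_self _ hp0)
    · have h2 : cfc (fun t : ℝ => max t 0) (-s) = cfc (fun t : ℝ => max (-t) 0) s :=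
        (cfc_comp_neg (fun t : ℝ => max t 0) s).symm
      rw [h2, sub_mul, one_mul, sub_eq_self] at h1
      exact h1
    · rw [le_sub_comm]
      refine hp.2 ?_
      rintro _ ⟨m, rfl⟩
      rw [← cfc_comp_neg (approxPos n) s, le_sub_iff_add_le, ← cfc_add ..]
      exact cfc_le_one _ _ fun t _ => approxPos_add_approxPos_neg_le_one m n t
  have hfix : ∀ n, p * cfc (approxPos n) s = cfc (approxPos n) s := by
    intro n
    have : cfc (approxPos n) s = cfc (fun t : ℝ => max t 0) s *
        cfc (fun t : ℝ => (n + 1) / (1 + (n + 1) * max t 0)) s := by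
      have hcont : Continuous fun t : ℝ => ((n : ℝ) + 1) / (1 + (n + 1) * max t 0) :=
        Continuous.div (by fun_prop) (by fun_prop) fun t => (one_add_mul_max_pos n t).ne'
      rw [← cfc_mul _ _ s (by fun_prop) hcont.continuousOn]
      refine cfc_congr fun t _ => ?_
      simp only [approxPos]
      ring
    rw [this, ← mul_assoc, hpos]
  -- p² is again an upper bound: fₙ(s) = p fₙ(s) p ≤ p².
  have hpp : p * p = p := by
    refine le_antisymm (sq_le_self_of_nonneg_of_le_one hp0 hp1) (hp.2 ?_)
    rintro _ ⟨n, rfl⟩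
    have h1 := hpsa.conjugate_le_conjugate
      (cfc_le_one (approxPos n) s fun t _ => approxPos_le_one n t)
    have hfsa : IsSelfAdjoint (cfc (approxPos n) s) := cfc_predicate _ _
    have h2 : cfc (approxPos n) s * p = cfc (approxPos n) s := by
      simpa [hpsa.star_eq, hfsa.star_eq] using congrArg star (hfix n)
    rwa [hfix, h2, mul_one] at h1
  -- Conjugation by w fixes every fₙ(s), so it carries upper bounds to upper bounds; w = u and w =
  -- u* together give equality.
  have hcomm : ∀ w ∈ unitary M, Commute s w → p ≤ w * p * star w := by
    intro w hw hsw
    refine hp.2 ?_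
    rintro _ ⟨n, rfl⟩
    have h1 : Commute (cfc (approxPos n) s) w := hs.commute_cfc hsw _
    have h2 := star_right_conjugate_le_conjugate (hle n) w
    rwa [← h1.eq, mul_assoc, Unitary.mul_star_self_of_mem hw, mul_one] at h2
  have h1 : u * p * star u = p := by
    refine le_antisymm ?_ (hcomm u hu hsu)
    have hsu' : Commute s (star u) := by simpa [hs.star_eq] using hsu.star_star
    have := star_right_conjugate_le_conjugate (hcomm (star u) (Unitary.star_mem hu) hsu') u
    rw [star_star] at this
    convert this using 1
    have h3 := Unitary.mul_star_self_of_mem hu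
    calc p = (u * star u) * p * (u * star u) := by rw [h3, one_mul, mul_one]
      _ = _ := by noncomm_ring
  refine ⟨p, ⟨hpp, hpsa⟩, ?_, hpos, hneg⟩
  calc p * u = u * p * star u * u := by rw [h1]
    _ = u * p := by rw [mul_assoc, Unitary.star_mul_self_of_mem hu, mul_one]

/-- ‖u - 1‖² = ‖2 - (u + u*)‖ ≤ 2 < 4. -/
lemma norm_sub_one_lt_two_of_nonneg_add_star {u : M} (hu : u ∈ unitary M) (h : 0 ≤ u + star u) :
    ‖u - 1‖ < 2 := by
  have h1 : star (u - 1) * (u - 1) = 2 - (u + star u) := by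
    rw [star_sub, star_one]
    have := Unitary.star_mul_self_of_mem hu
    calc _ = star u * u - star u - u + 1 := by noncomm_ring
      _ = _ := by rw [this, ← one_add_one_eq_two]; abel
  have h2 : ‖star (u - 1) * (u - 1)‖ ≤ 2 := by
    refine (CStarAlgebra.norm_le_iff_le_algebraMap _ (by norm_num) (star_mul_self_nonneg _)).2 ?_
    rw [h1, map_ofNat]
    exact sub_le_self _ h
  rw [CStarRing.norm_star_mul_self] at h2
  nlinarith

end Sign

/-! ### Connectedness of the unitary group. -/

/-- The unitary group of a `W⋆`-algebra is path connected. -/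
theorem joined_one_unitary {M : Type*} [CStarAlgebra M] [WStarAlgebra M] (u : unitary M) :
    Joined 1 u := by
  let _ := CStarAlgebra.spectralOrder M
  have _ := CStarAlgebra.spectralOrderedRing M
  obtain ⟨u, hu⟩ := u
  have huu := Unitary.star_mul_self_of_mem hu
  have huu' := Unitary.mul_star_self_of_mem hu
  set s : M := (imaginaryPart u : M) with hs
  have hssa : IsSelfAdjoint s := (imaginaryPart u).2
  have hsI : u - star u = (2 * Complex.I) • s := by
    rw [hs, imaginaryPart_apply_coe, smul_smul, ← Complex.coe_smul, smul_smul]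
    have : 2 * Complex.I * -Complex.I * ((2⁻¹ : ℝ) : ℂ) = 1 := by
      push_cast
      linear_combination (-1 : ℂ) * Complex.I_mul_I
    rw [this, one_smul]
  have hsu : Commute s u := by
    have : Commute (star u) u := by rw [commute_iff_eq, huu, huu']
    rw [hs, imaginaryPart_apply_coe]
    exact (((Commute.refl u).sub_left this).smul_left _).smul_left _
  obtain ⟨p, hp, hpu, hp1, hp2⟩ := exists_isStarProjection_posPart hssa hu hsu
  -- A symmetry commuting with u, chosen so that e s = |s|.
  set e : M := 2 * p - 1 with he
  have hesa : star e = e := by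
    simp [he, hp.isSelfAdjoint.star_eq, two_mul]
  have hee : e * e = 1 := by
    have := hp.isIdempotentElem.eq
    calc e * e = 4 * (p * p) - 4 * p + 1 := by rw [he]; noncomm_ring
      _ = 1 := by rw [this]; simp
  have heu : e * u = u * e := by
    have := hpu.eq
    calc e * u = 2 * (p * u) - u := by rw [he]; noncomm_ring
      _ = _ := by rw [this, he]; noncomm_ring
  have heu' : e * star u = star u * e := by
    simpa [hesa] using (congrArg star heu).symm
  have hes : 0 ≤ e * s := by
    have h1 : s = cfc (fun t : ℝ => max t 0) s - cfc (fun t : ℝ => max (-t) 0) s := by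
      conv_lhs => rw [← cfc_id ℝ s]
      rw [← cfc_sub ..]
      refine cfc_congr fun t _ => ?_
      simp only [id]
      rcases le_total t 0 with h | h <;> simp [h]
    have h2 : e * s = cfc (fun t : ℝ => max t 0) s + cfc (fun t : ℝ => max (-t) 0) s := by
      conv_lhs => rw [h1]
      calc _ = 2 * (p * cfc (fun t : ℝ => max t 0) s) - cfc (fun t : ℝ => max t 0) s
          - (2 * (p * cfc (fun t : ℝ => max (-t) 0) s) - cfc (fun t : ℝ => max (-t) 0) s) := by
            rw [he]; noncomm_ring
        _ = _ := by rw [hp1, hp2]; noncomm_ring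
    rw [h2]
    exact add_nonneg (cfc_nonneg fun t _ => le_max_right _ _)
      (cfc_nonneg fun t _ => le_max_right _ _)
  -- Factor u = (ie)(-ieu). Adding the adjoint gives 0 for the first factor and 2es ≥ 0 for the
  -- second.
  have hv : Complex.I • e ∈ unitary M := by
    rw [Unitary.mem_iff]
    simp [hesa, hee, smul_smul]
  have hw : (-Complex.I) • (e * u) ∈ unitary M := by
    rw [Unitary.mem_iff]
    constructor
    · simp only [star_smul, star_mul, hesa, smul_mul_smul_comm]
      rw [mul_assoc, ← mul_assoc e e, hee, one_mul, huu]; simp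
    · simp only [star_smul, star_mul, hesa, smul_mul_smul_comm]
      rw [mul_assoc, ← mul_assoc u, huu', one_mul, hee]; simp
  have hv2 : ‖Complex.I • e - 1‖ < 2 :=
    norm_sub_one_lt_two_of_nonneg_add_star hv (by simp [hesa])
  have hw2 : ‖(-Complex.I) • (e * u) - 1‖ < 2 := by
    refine norm_sub_one_lt_two_of_nonneg_add_star hw ?_
    have : (-Complex.I) • (e * u) + star ((-Complex.I) • (e * u)) = (2 : ℝ) • (e * s) := by
      calc _ = (-Complex.I) • (e * (u - star u)) := by
            simp [hesa, mul_sub, heu', smul_sub]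
        _ = _ := by
          rw [hsI, mul_smul_comm, smul_smul, ← Complex.coe_smul]
          congr 1
          push_cast
          linear_combination (-2 : ℂ) * Complex.I_mul_I
    rw [this]
    exact smul_nonneg zero_le_two hes
  have j1 : Joined (1 : unitary M) ⟨_, hv⟩ := Unitary.joined 1 ⟨_, hv⟩ hv2
  have j2 : Joined (1 : unitary M) ⟨_, hw⟩ := Unitary.joined 1 ⟨_, hw⟩ hw2
  have := j1.mul j2
  convert this using 1
  · simp
  · ext
    simp [smul_smul, ← mul_assoc, hee]

/-! ### Smooth local retracts are split submanifolds. -/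

section Retract

variable {X : Type*} [NormedAddCommGroup X] [NormedSpace ℝ X] [CompleteSpace X]

/-- A `C^∞` map with invertible derivative at `x` restricts to a diffeomorphism between open
neighbourhoods inside any prescribed neighbourhood. -/
lemma exists_contDiffOn_openPartialHomeomorph {f : X → X} {x : X}
    (hf : ∀ᶠ y in 𝓝 x, ContDiffAt ℝ ∞ f y)
    (hf' : HasFDerivAt f (ContinuousLinearMap.id ℝ X) x) {U : Set X} (hU : U ∈ 𝓝 x) :
    ∃ φ : OpenPartialHomeomorph X X, x ∈ φ.source ∧ φ.source ⊆ U ∧ (φ : X → X) = f ∧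
      ContDiffOn ℝ ∞ φ φ.source ∧ ContDiffOn ℝ ∞ φ.symm φ.target := by
  have hfx := hf.self_of_nhds
  have hf'' : HasFDerivAt f (ContinuousLinearEquiv.refl ℝ X : X →L[ℝ] X) x := hf'
  -- Smoothness of the inverse on the whole target needs an invertible derivative at nearby points
  -- as well.
  have hinv : ∀ᶠ y in 𝓝 x, fderiv ℝ f y ∈ Set.range ((↑) : (X ≃L[ℝ] X) → X →L[ℝ] X) := by
    have hc : ContinuousAt (fderiv ℝ f) x :=
      (hfx.fderiv_right (m := 0) (by simp)).continuousAt
    refine hc.eventually (ContinuousLinearEquiv.isOpen.mem_nhds ?_)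
    exact ⟨_, hf''.fderiv.symm⟩
  obtain ⟨W, hW, hWo, hxW⟩ := mem_nhds_iff.1 (inter_mem (inter_mem hf hinv) hU)
  let φ := (hfx.toOpenPartialHomeomorph f hf'' (by simp)).restrOpen W hWo
  have hφW : ∀ y ∈ φ.source, y ∈ W := fun y hy => hy.2
  refine ⟨φ, ⟨hfx.mem_toOpenPartialHomeomorph_source hf'' (by simp), hxW⟩,
    fun y hy => (hW (hφW y hy)).2, rfl, fun y hy =>
      ContDiffAt.contDiffWithinAt (f := f) (hW (hφW y hy)).1.1, ?_⟩
  intro y hy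
  have hy' := hW (hφW _ (φ.map_target hy))
  obtain ⟨e, he⟩ := hy'.1.2
  have hcd : ContDiffAt ℝ ∞ f (φ.symm y) := hy'.1.1
  refine (φ.contDiffAt_symm hy (f₀' := e) ?_ hcd).contDiffWithinAt
  rw [he]
  exact (hcd.differentiableAt (by simp)).hasFDerivAt

/-- A set which near each of its points is a smooth local retract is a split submanifold. -/
theorem isEmbeddedSplitSubmanifold_of_retract {S : Set X}
    (h : ∀ b ∈ S, ∃ r : X → X, (∀ᶠ x in 𝓝 b, ContDiffAt ℝ ∞ r x) ∧ (∀ᶠ x in 𝓝 b, r x ∈ S) ∧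
      ∀ᶠ x in 𝓝 b, x ∈ S → r x = x) : IsEmbeddedSplitSubmanifold S := by
  intro b hb
  obtain ⟨r, hre, hrS, hrid⟩ := h b hb
  have hr := hre.self_of_nhds
  have hrb : r b = b := hrid.self_of_nhds hb
  have hrd : HasFDerivAt r (fderiv ℝ r b) b := (hr.differentiableAt (by simp)).hasFDerivAt
  set P := fderiv ℝ r b with hP
  have htend : Tendsto r (𝓝 b) (𝓝 b) := by simpa [ContinuousAt, hrb] using hr.continuousAt
  have hrr : ∀ᶠ x in 𝓝 b, r (r x) = r x := by
    filter_upwards [hrS, htend.eventually hrid] with x h1 h2 using h2 h1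
  have hPP : P.comp P = P := by
    have h1 : HasFDerivAt (r ∘ r) (P.comp P) b := by
      refine HasFDerivAt.comp b ?_ hrd
      rwa [hrb]
    exact h1.unique (hrd.congr_of_eventuallyEq hrr)
  have hPPx : ∀ x, P (P x) = P x := fun x => DFunLike.congr_fun hPP x
  -- P is idempotent, so f = P(r x - b) + (1 - P)(x - r x) has derivative P + (1 - P) = 1 at b; its
  -- second term vanishes on S.
  let f : X → X := fun x => P (r x - b) + ((x - r x) - P (x - r x))
  have hf : ∀ᶠ x in 𝓝 b, ContDiffAt ℝ ∞ f x := by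
    filter_upwards [hre] with x hr
    have hid := contDiffAt_id (𝕜 := ℝ) (n := ∞) (x := x)
    exact (P.contDiff.contDiffAt.comp x (hr.sub contDiffAt_const)).add
      ((hid.sub hr).sub (P.contDiff.contDiffAt.comp x (hid.sub hr)))
  have hf' : HasFDerivAt f (ContinuousLinearMap.id ℝ X) b := by
    have h1 := (P.hasFDerivAt.comp b (hrd.sub_const b)).add
      (((hasFDerivAt_id b).sub hrd).sub (P.hasFDerivAt.comp b ((hasFDerivAt_id b).sub hrd)))
    refine h1.congr_fderiv ?_
    ext x
    simp [hPPx]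
  -- ψ serves only for injectivity of f; φ is shrunk so that x and r x both lie in its source.
  obtain ⟨ψ, hbψ, -, hψ, -, -⟩ := exists_contDiffOn_openPartialHomeomorph hf hf' univ_mem
  obtain ⟨φ, hbφ, hφU, hφ, hφ1, hφ2⟩ := exists_contDiffOn_openPartialHomeomorph hf hf'
    (inter_mem (inter_mem (inter_mem hrS hrid) hrr) (inter_mem (ψ.open_source.mem_nhds hbψ)
      (htend.eventually (ψ.open_source.mem_nhds hbψ))))
  refine ⟨P.range, φ, ?_, hbφ, hφ1, hφ2, ?_⟩
  · exact ⟨P.rangeRestrict, by rintro ⟨_, x, rfl⟩; ext; simp [hPPx]⟩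
  apply Set.Subset.antisymm
  · rintro _ ⟨x, ⟨hx, hxS⟩, rfl⟩
    refine ⟨φ.map_source hx, ?_⟩
    rw [hφ]
    exact ⟨r x - b, by simp [f, (hφU hx).1.1.2 hxS]⟩
  · rintro y ⟨hy, hyT⟩
    have hx := φ.map_target hy
    obtain ⟨⟨⟨h1, h2⟩, h3⟩, h4, h5⟩ := hφU hx
    refine ⟨φ.symm y, ⟨hx, ?_⟩, φ.right_inv hy⟩
    set x := φ.symm y
    have hfx : f x ∈ P.range := by
      rw [← hφ, φ.right_inv hy]; exact hyT
    have hPf : P (f x) = f x := by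
      obtain ⟨z, hz⟩ := hfx
      rw [← hz]; exact hPPx z
    -- If f x lies in the range of P, then f x = P(r x - b) = f (r x), which forces r x = x.
    have hfr : f (r x) = f x := by
      rw [← hPf]
      have h3 : r (r x) = r x := h3
      simp [f, h3, hPPx]
    have : r x = x := ψ.injOn h5 h4 (by rw [hψ]; exact hfr)
    rw [← this]
    exact h1

end Retract

/-! ### Spectral projections as polynomials, and the intertwiner. -/

section NormalZeros

variable {M : Type*} [CStarAlgebra M]

variable (M) in
/-- The normal elements with spectrum in the finite set `Λ`, described by closed conditions. -/
def normalZeros (Λ : Finset ℂ) : Set M :=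
  {x | IsStarNormal x ∧ aeval x (Lagrange.nodal Λ id) = 0}

variable {Λ : Finset ℂ}

lemma continuous_aeval (p : ℂ[X]) : Continuous fun x : M => aeval x p :=
  p.continuous_aeval

lemma contDiff_aeval (p : ℂ[X]) : ContDiff ℝ ω fun x : M => aeval x p := by
  induction p using Polynomial.induction_on' with
  | add p q hp hq => simpa only [map_add] using hp.add hq
  | monomial n c =>
    simp only [aeval_monomial]
    exact contDiff_const.mul (contDiff_id.pow n)

lemma isClosed_normalZeros : IsClosed (normalZeros M Λ) := by
  have : normalZeros M Λ = {x | star x * x = x * star x} ∩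
      {x | aeval x (Lagrange.nodal Λ id) = 0} := by
    ext x
    simp [normalZeros, isStarNormal_iff, commute_iff_eq]
  rw [this]
  exact (isClosed_eq (by fun_prop) (by fun_prop)).inter
    (isClosed_eq (continuous_aeval _) continuous_const)

lemma spectrum_subset_of_mem_normalZeros {x : M} (hx : x ∈ normalZeros M Λ) :
    spectrum ℂ x ⊆ Λ := by
  intro t ht
  have := spectrum.subset_polynomial_aeval x (Lagrange.nodal Λ id) ⟨t, ht, rfl⟩
  rw [hx.2] at this
  rcases subsingleton_or_nontrivial M with hM | hM
  · simp [spectrum.of_subsingleton] at ht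
  rw [spectrum.zero_eq, Set.mem_singleton_iff] at this
  by_contra h
  refine Lagrange.eval_nodal_not_at_node (s := Λ) (v := id) (x := t) ?_ this
  rintro i hi rfl
  exact h hi

lemma aeval_eq_of_mem_normalZeros {x : M} (hx : x ∈ normalZeros M Λ) {p q : ℂ[X]}
    (h : ∀ t ∈ Λ, p.eval t = q.eval t) : aeval x p = aeval x q := by
  have := hx.1
  rw [← cfc_polynomial p x, ← cfc_polynomial q x]
  exact cfc_congr fun t ht => h t (spectrum_subset_of_mem_normalZeros hx ht)

/-- The spectral projection of `x ∈ normalZeros M Λ` at `t`, as a polynomial in `x`. -/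
noncomputable def spectralProj (Λ : Finset ℂ) (t : ℂ) (x : M) : M :=
  aeval x (Lagrange.basis Λ id t)

lemma eval_basis_id {t v : ℂ} (hv : v ∈ Λ) :
    (Lagrange.basis Λ id t).eval v = if v = t then 1 else 0 := by
  split_ifs with h
  · subst h
    exact Lagrange.eval_basis_self Function.injective_id.injOn hv
  · exact Lagrange.eval_basis_of_ne (v := id) (Ne.symm h) hv

lemma mul_spectralProj {x : M} (hx : x ∈ normalZeros M Λ) (t : ℂ) :
    x * spectralProj Λ t x = t • spectralProj Λ t x := by
  have := aeval_eq_of_mem_normalZeros hx (p := X * Lagrange.basis Λ id t)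
    (q := C t * Lagrange.basis Λ id t) fun v hv => by
      simp only [eval_mul, eval_X, eval_C, eval_basis_id hv]
      split_ifs with h <;> simp [h]
  simpa [spectralProj, Algebra.smul_def] using this

lemma spectralProj_mul {x : M} (hx : x ∈ normalZeros M Λ) (t : ℂ) :
    spectralProj Λ t x * x = t • spectralProj Λ t x := by
  have := aeval_eq_of_mem_normalZeros hx (p := Lagrange.basis Λ id t * X)
    (q := C t * Lagrange.basis Λ id t) fun v hv => by
      simp only [eval_mul, eval_X, eval_C, eval_basis_id hv]
      split_ifs with h <;> simp [h]
  simpa [spectralProj, Algebra.smul_def] using this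

lemma spectralProj_mul_self {x : M} (hx : x ∈ normalZeros M Λ) (t : ℂ) :
    spectralProj Λ t x * spectralProj Λ t x = spectralProj Λ t x := by
  have := aeval_eq_of_mem_normalZeros hx (p := Lagrange.basis Λ id t * Lagrange.basis Λ id t)
    (q := Lagrange.basis Λ id t) fun v hv => by
      simp only [eval_mul, eval_basis_id hv]
      split_ifs <;> simp
  simpa [spectralProj] using this

lemma star_spectralProj {x : M} (hx : x ∈ normalZeros M Λ) (t : ℂ) :
    star (spectralProj Λ t x) = spectralProj Λ t x := by
  have := hx.1
  rw [spectralProj, ← cfc_polynomial _ x, ← cfc_star]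
  refine cfc_congr fun v hv => ?_
  simp only [eval_basis_id (spectrum_subset_of_mem_normalZeros hx hv)]
  split_ifs <;> simp

/-- An element intertwining nearby `b` and `x` in `normalZeros M Λ`. -/
noncomputable def intertwiner (Λ : Finset ℂ) (b x : M) : M :=
  ∑ t ∈ Λ, spectralProj Λ t x * spectralProj Λ t b

lemma contDiff_intertwiner (b : M) : ContDiff ℝ ω (intertwiner Λ b) := by
  unfold intertwiner
  exact ContDiff.sum fun t _ => (contDiff_aeval _).mul contDiff_const

lemma intertwiner_self (hΛ : Λ.Nonempty) {b : M} (hb : b ∈ normalZeros M Λ) :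
    intertwiner Λ b b = 1 := by
  simp only [intertwiner, spectralProj_mul_self hb]
  simp only [spectralProj, ← map_sum]
  rw [Lagrange.sum_basis Function.injective_id.injOn hΛ, map_one]

/-- Both sides equal Σ t e_t(x) e_t(b). -/
lemma mul_intertwiner {b x : M} (hb : b ∈ normalZeros M Λ) (hx : x ∈ normalZeros M Λ) :
    x * intertwiner Λ b x = intertwiner Λ b x * b := by
  simp only [intertwiner, Finset.mul_sum, Finset.sum_mul]
  refine Finset.sum_congr rfl fun t _ => ?_
  rw [← mul_assoc, mul_spectralProj hx, mul_assoc, spectralProj_mul hb]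
  simp

lemma star_intertwiner_mul {b x : M} (hb : b ∈ normalZeros M Λ) (hx : x ∈ normalZeros M Λ) :
    star (intertwiner Λ b x) * x = b * star (intertwiner Λ b x) := by
  simp only [intertwiner, star_sum, star_mul, star_spectralProj hb, star_spectralProj hx,
    Finset.mul_sum, Finset.sum_mul]
  refine Finset.sum_congr rfl fun t _ => ?_
  rw [← mul_assoc, mul_spectralProj hb, mul_assoc, spectralProj_mul hx]
  simp

end NormalZeros

/-! ### A smooth square root near 1. -/

section Sqrt
variable {M : Type*} [CStarAlgebra M]

/-- The square root is smooth near `1`. -/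
lemma exists_contDiffAt_sqrt : ∃ g : M → M, ContDiffAt ℝ ω g 1 ∧ g 1 = 1 ∧
    ∀ᶠ y in 𝓝 (1 : M), g y * g y = y ∧ (IsSelfAdjoint y →
      IsSelfAdjoint (g y) ∧ ∀ b, Commute y b → Commute (g y) b) := by
  -- The factor 1/2 makes the derivative at 1 the identity.
  let f : M → M := fun y => (2⁻¹ : ℝ) • (y * y)
  have hf : ContDiffAt ℝ ω f 1 := by fun_prop
  have hf' : HasFDerivAt f (ContinuousLinearEquiv.refl ℝ M : M →L[ℝ] M) 1 := by
    have := ((hasFDerivAt_id (𝕜 := ℝ) (1 : M)).mul' (hasFDerivAt_id (𝕜 := ℝ) (1 : M))).const_smul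
      (2⁻¹ : ℝ)
    refine this.congr_fderiv ?_
    ext x
    have : (2⁻¹ : ℝ) • x + (2⁻¹ : ℝ) • x = x := by rw [← add_smul]; norm_num
    simpa using this
  have hf1 : f 1 = (2⁻¹ : ℝ) • (1 : M) := by simp [f]
  let g₀ := hf.localInverse hf' (by simp)
  have hg₀ : ContDiffAt ℝ ω g₀ ((2⁻¹ : ℝ) • (1 : M)) := hf1 ▸ hf.to_localInverse hf' (by simp)
  have hst := hf.hasStrictFDerivAt' hf' (by simp)
  have hsmul : ContDiff ℝ ω fun y : M => (2⁻¹ : ℝ) • y := by fun_prop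
  have hg : ContDiffAt ℝ ω (fun y => g₀ ((2⁻¹ : ℝ) • y)) 1 := hg₀.comp 1 hsmul.contDiffAt
  have hg1 : g₀ ((2⁻¹ : ℝ) • (1 : M)) = 1 := by
    rw [← hf1]; exact hf.localInverse_apply_image hf' (by simp)
  refine ⟨fun y => g₀ ((2⁻¹ : ℝ) • y), hg, hg1, ?_⟩
  have htend : Tendsto (fun y => g₀ ((2⁻¹ : ℝ) • y)) (𝓝 1) (𝓝 1) := by
    have := hg.continuousAt.tendsto
    rwa [hg1] at this
  have htstar : Tendsto (fun y => star (g₀ ((2⁻¹ : ℝ) • y))) (𝓝 1) (𝓝 1) := by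
    simpa using htend.star
  have hright : ∀ᶠ y in 𝓝 (1 : M), f (g₀ ((2⁻¹ : ℝ) • y)) = (2⁻¹ : ℝ) • y := by
    have h1 : Tendsto (fun y : M => (2⁻¹ : ℝ) • y) (𝓝 1) (𝓝 (f 1)) := by
      rw [hf1]; exact hsmul.continuous.tendsto 1
    exact h1.eventually hst.eventually_right_inverse
  have hleft : ∀ᶠ y in 𝓝 (1 : M), g₀ (f y) = y := hst.eventually_left_inverse
  have hball : ∀ᶠ y in 𝓝 (1 : M), ‖1 - y‖ ≤ 1 := by
    filter_upwards [Metric.closedBall_mem_nhds (1 : M) zero_lt_one] with y hy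
    rwa [mem_closedBall_iff_norm'] at hy
  filter_upwards [hright, htend.eventually hleft, htstar.eventually hleft,
    htend.eventually hball] with y h1 h2 h3 h4
  have hgg : g₀ ((2⁻¹ : ℝ) • y) * g₀ ((2⁻¹ : ℝ) • y) = y :=
    smul_right_injective M (by norm_num : (2⁻¹ : ℝ) ≠ 0) h1
  refine ⟨hgg, fun hy => ?_⟩
  -- The adjoint is another preimage near 1, so local injectivity identifies the two.
  have hsa : IsSelfAdjoint (g₀ ((2⁻¹ : ℝ) • y)) := by
    rw [isSelfAdjoint_iff, ← h3]
    refine Eq.trans ?_ h2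
    simp only [f, ← star_mul, hgg, hy.star_eq]
  refine ⟨hsa, fun b hb => ?_⟩
  let _ := CStarAlgebra.spectralOrder M
  have _ := CStarAlgebra.spectralOrderedRing M
  -- ‖1 - g‖ ≤ 1 forces g ≥ 0, so g is the positive root, a continuous function of y, and commutes
  -- with whatever y does.
  have hpos : 0 ≤ g₀ ((2⁻¹ : ℝ) • y) := by
    have h5 : IsSelfAdjoint (1 - g₀ ((2⁻¹ : ℝ) • y)) := (IsSelfAdjoint.one M).sub hsa
    have h6 := h5.le_algebraMap_norm_self.trans (algebraMap_mono M h4)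
    simpa using h6
  have := CFC.sqrt_unique hgg hpos
  rw [← this]
  exact hb.cfcₙ_nnreal _
end Sqrt

/-! ### The local retraction onto a unitary orbit. -/

section LocalRetraction

variable {M : Type*} [CStarAlgebra M] {Λ : Finset ℂ}

/-- Near `b`, the set `normalZeros M Λ` is a smooth retract contained in the unitary orbit of `b`. -/
theorem exists_retraction_unitaryOrbit (hΛ : Λ.Nonempty) {b : M} (hb : b ∈ normalZeros M Λ) :
    ∃ r : M → M, ContDiffAt ℝ ω r b ∧ (∀ᶠ x in 𝓝 b, r x ∈ unitaryOrbit b) ∧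
      ∀ᶠ x in 𝓝 b, x ∈ normalZeros M Λ → r x = x := by
  obtain ⟨g, hg, hg1, hgy⟩ := exists_contDiffAt_sqrt (M := M)
  let z := intertwiner Λ b
  have hz : ContDiff ℝ ω z := contDiff_intertwiner b
  have hzb : z b = 1 := intertwiner_self hΛ hb
  have hstar : ContDiff ℝ ω (star : M → M) := (starL' ℝ : M ≃L[ℝ] M).contDiff
  let y : M → M := fun x => star (z x) * z x
  have hy : ContDiff ℝ ω y := (hstar.comp hz).mul hz
  have hyb : y b = 1 := by simp [y, hzb]
  let k : M → M := fun x => g (y x)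
  have hk : ContDiffAt ℝ ω k b := ContDiffAt.comp b (hyb ▸ hg) hy.contDiffAt
  have hkb : k b = 1 := by simp [k, hyb, hg1]
  -- The unitary polar part z (z*z)^(-1/2).
  let u : M → M := fun x => z x * Ring.inverse (k x)
  have hu : ContDiffAt ℝ ω u b := by
    have hinv : ContDiffAt ℝ ω (Ring.inverse : M → M) (k b) := by
      rw [hkb]
      exact contDiffAt_ringInverse ℝ (1 : Mˣ)
    exact hz.contDiffAt.mul (hinv.comp b hk)
  have hunit : ∀ᶠ x in 𝓝 (1 : M), IsUnit x := Units.isOpen.mem_nhds isUnit_one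
  have htz : Tendsto z (𝓝 b) (𝓝 1) := hzb ▸ hz.continuous.tendsto b
  have hty : Tendsto y (𝓝 b) (𝓝 1) := hyb ▸ hy.continuous.tendsto b
  have htk : Tendsto k (𝓝 b) (𝓝 1) := hkb ▸ hk.continuousAt.tendsto
  have hev : ∀ᶠ x in 𝓝 b, u x ∈ unitary M ∧ u x * k x = z x ∧ IsUnit (k x) ∧
      ∀ c, Commute (y x) c → Commute (k x) c := by
    filter_upwards [htz.eventually hunit, htk.eventually hunit, hty.eventually hgy]
      with x h1 h2 h3
    obtain ⟨hkk, hksa⟩ := h3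
    obtain ⟨hksa, hcomm⟩ := hksa (IsSelfAdjoint.star_mul_self _)
    have hksa : star (k x) = k x := hksa
    have hkk : k x * k x = star (z x) * z x := hkk
    have huk : u x * k x = z x := by
      simp only [u, mul_assoc, Ring.inverse_mul_cancel _ h2, mul_one]
    have huu : star (u x) * u x = 1 := by
      have h4 : k x * (star (u x) * u x) * k x = k x * 1 * k x := by
        calc _ = star (k x) * star (u x) * (u x * k x) := by rw [hksa]; simp only [mul_assoc]
          _ = _ := by rw [← star_mul, huk, mul_one, hkk]
      exact h2.mul_left_cancel (h2.mul_right_cancel h4)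
    have huunit : IsUnit (u x) := h1.mul (isUnit_ringInverse.2 h2)
    refine ⟨Unitary.mem_iff.2 ⟨huu, ?_⟩, huk, h2, hcomm⟩
    exact huunit.mul_right_cancel (by rw [mul_assoc, huu, mul_one, one_mul])
  refine ⟨fun x => u x * b * star (u x), ?_, ?_, ?_⟩
  · exact (hu.mul contDiffAt_const).mul (hstar.contDiffAt.comp b hu)
  · filter_upwards [hev] with x hx using ⟨u x, hx.1, rfl⟩
  · filter_upwards [hev] with x ⟨h1, h2, h3, h4⟩ hx
    -- From xz = zb and z*x = bz*, z*z commutes with b; so does its root, and u inherits the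
    -- intertwining relation.
    have hyc : Commute (y x) b := by
      have e1 := mul_intertwiner hb hx
      have e2 := star_intertwiner_mul hb hx
      change star (z x) * z x * b = b * (star (z x) * z x)
      rw [mul_assoc, ← e1, ← mul_assoc, e2, mul_assoc]
    have e3 : x * u x = u x * b := by
      refine h3.mul_right_cancel ?_
      rw [mul_assoc, h2, mul_assoc, ← (h4 b hyc).eq, ← mul_assoc, h2]
      exact mul_intertwiner hb hx
    change u x * b * star (u x) = x
    rw [← e3, mul_assoc, Unitary.mul_star_self_of_mem h1, mul_one]

end LocalRetraction

/-! ### Unitary orbits inside the groupoid orbit. -/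

section Orbits

variable {M : Type*} [CStarAlgebra M]

lemma mem_unitaryOrbit_self (b : M) : b ∈ unitaryOrbit b := ⟨1, one_mem _, by simp⟩

lemma mem_unitaryOrbit_symm {b c : M} (h : c ∈ unitaryOrbit b) : b ∈ unitaryOrbit c := by
  obtain ⟨u, hu, rfl⟩ := h
  refine ⟨star u, Unitary.star_mem hu, ?_⟩
  have := Unitary.star_mul_self_of_mem hu
  rw [star_star]
  calc b = star u * u * b * (star u * u) := by rw [this, one_mul, mul_one]
    _ = _ := by simp only [mul_assoc]

lemma mem_unitaryOrbit_trans {b c d : M} (h : c ∈ unitaryOrbit b) (h' : d ∈ unitaryOrbit c) :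
    d ∈ unitaryOrbit b := by
  obtain ⟨u, hu, rfl⟩ := h
  obtain ⟨v, hv, rfl⟩ := h'
  exact ⟨v * u, mul_mem hv hu, by simp only [star_mul, mul_assoc]⟩

lemma unitaryOrbit_eq_of_mem {b c : M} (h : c ∈ unitaryOrbit b) :
    unitaryOrbit c = unitaryOrbit b :=
  Set.Subset.antisymm (fun _ hd => mem_unitaryOrbit_trans h hd)
    fun _ hd => mem_unitaryOrbit_trans (mem_unitaryOrbit_symm h) hd

lemma disjoint_unitaryOrbit {b c : M} (h : unitaryOrbit b ≠ unitaryOrbit c) :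
    Disjoint (unitaryOrbit b) (unitaryOrbit c) := by
  rw [Set.disjoint_left]
  intro x hb hc
  exact h ((unitaryOrbit_eq_of_mem hb).symm.trans (unitaryOrbit_eq_of_mem hc))

lemma unitaryOrbit_subset_groupoidOrbit {a b : M} (hb : b ∈ groupoidOrbit a) :
    unitaryOrbit b ⊆ groupoidOrbit a := by
  obtain ⟨v, hv, rfl⟩ := hb
  rintro _ ⟨u, hu, rfl⟩
  have h : star (u * v) * (u * v) = star v * v := by
    rw [star_mul, mul_assoc, ← mul_assoc (star u), Unitary.star_mul_self_of_mem hu, one_mul]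
  refine ⟨u * v, ⟨?_, ?_⟩, by simp only [star_mul, mul_assoc]⟩
  · simpa only [partialIsometries, Set.mem_ofPred_eq, h] using hv.1
  · simpa only [h] using hv.2

lemma isPreconnected_unitaryOrbit [WStarAlgebra M] (b : M) : IsPreconnected (unitaryOrbit b) := by
  have : PathConnectedSpace (unitary M) :=
    pathConnectedSpace_iff_univ.2 ⟨1, trivial, fun {u} _ => (joinedIn_univ).2 (joined_one_unitary u)⟩
  have h : unitaryOrbit b = Set.range fun u : unitary M => (u : M) * b * star (u : M) := by
    ext x
    simp [unitaryOrbit, eq_comm]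
  rw [h]
  exact isPreconnected_range (by fun_prop)

end Orbits

/-! ### The groupoid orbit lies in `normalZeros`. -/

section RangeProjection

variable {M : Type*} [CStarAlgebra M]

/-- On a finite spectrum the indicator of t ≠ 0 is continuous; applied to a, it gives a projection
that commutes with a and turns out to be p. -/
lemma mul_right_eq_of_isRangeProjection {a p : M} (ha : IsStarNormal a)
    (hspec : (spectrum ℂ a).Finite) (hp : IsRangeProjection a p) : a * p = a := by
  set p₀ : M := cfc (fun t : ℂ => if t = 0 then 0 else 1) a with hp₀
  have hcont : ∀ f : ℂ → ℂ, ContinuousOn f (spectrum ℂ a) := fun f => hspec.continuousOn f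
  have hp₀proj : IsStarProjection p₀ := by
    constructor
    · change p₀ * p₀ = p₀
      rw [hp₀, ← cfc_mul _ _ a (hcont _) (hcont _)]
      exact cfc_congr fun t _ => by split_ifs <;> simp
    · rw [isSelfAdjoint_iff, hp₀, ← cfc_star]
      exact cfc_congr fun t _ => by split_ifs <;> simp
  have hp₀a : p₀ * a = a := by
    have : p₀ * cfc (fun t : ℂ => t) a = cfc (fun t : ℂ => t) a := by
      rw [hp₀, ← cfc_mul _ _ a (hcont _) (hcont _)]
      exact cfc_congr fun t _ => by
        split_ifs with h <;> simp [h]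
    rwa [cfc_id' ℂ a] at this
  have h1 : p₀ * p = p := hp.2.2 p₀ hp₀proj hp₀a
  -- Uses 0⁻¹ = 0.
  have h2 : p₀ = a * cfc (fun t : ℂ => t⁻¹) a := by
    have : p₀ = cfc (fun t : ℂ => t) a * cfc (fun t : ℂ => t⁻¹) a := by
      rw [hp₀, ← cfc_mul _ _ a (hcont _) (hcont _)]
      exact cfc_congr fun t _ => by
        split_ifs with h <;> simp [h]
    rwa [cfc_id' ℂ a] at this
  have h3 : p * p₀ = p₀ := by rw [h2, ← mul_assoc, hp.2.1]
  have h4 : p₀ = p := by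
    have := congrArg star h3
    rw [star_mul, hp₀proj.isSelfAdjoint.star_eq, hp.1.isSelfAdjoint.star_eq, h1] at this
    exact this.symm
  rw [← h4, ← (Commute.cfc (Commute.refl a) ha.star_comm_self _).eq]
  exact hp₀a

lemma groupoidOrbit_subset_normalZeros {a : M} (ha : IsStarNormal a)
    (hspec : (spectrum ℂ a).Finite) :
    groupoidOrbit a ⊆ normalZeros M (insert 0 hspec.toFinset) := by
  rintro _ ⟨v, hv, rfl⟩
  have hpa : star v * v * a = a := hv.2.2.1
  have hap : a * (star v * v) = a := mul_right_eq_of_isRangeProjection ha hspec hv.2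
  have hpa' : star v * v * star a = star a := by simpa using congrArg star hap
  have hcomm := ha.star_comm_self.eq
  refine ⟨⟨?_⟩, ?_⟩
  · rw [commute_iff_eq]
    simp only [star_mul, star_star]
    calc v * (star a * star v) * (v * a * star v)
        = v * star a * (star v * v * a) * star v := by simp only [mul_assoc]
      _ = v * (star a * a) * star v := by rw [hpa]; simp only [mul_assoc]
      _ = v * a * star a * star v := by rw [hcomm]; simp only [mul_assoc]
      _ = v * a * (star v * v * star a) * star v := by rw [hpa']
      _ = _ := by simp only [mul_assoc]
  · have hx : v * a * star v * v = v * a := by rw [mul_assoc, mul_assoc, hap]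
    have hint : ∀ q : ℂ[X], aeval (v * a * star v) q * v = v * aeval a q := by
      intro q
      induction q using Polynomial.induction_on with
      | C c => simp [Algebra.commutes]
      | add p q hp hq => simp only [map_add, add_mul, mul_add, hp, hq]
      | monomial n c h =>
        have e1 : (C c * X ^ (n + 1) : ℂ[X]) = C c * X ^ n * X := by rw [pow_succ, mul_assoc]
        rw [e1, map_mul _ (C c * X ^ n), aeval_X, mul_assoc, hx, ← mul_assoc, h,
          map_mul _ (C c * X ^ n), aeval_X, mul_assoc]
    -- Without a constant term, q(vav*) = v q(a) v*; this is why 0 is among the nodes.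
    have hdvd : (X : ℂ[X]) ∣ Lagrange.nodal (insert 0 hspec.toFinset) id := by
      simpa using Lagrange.X_sub_C_dvd_nodal (R := ℂ) id (Finset.mem_insert_self 0 hspec.toFinset)
    have hzero : aeval a (Lagrange.nodal (insert 0 hspec.toFinset) id) = 0 := by
      rw [← cfc_polynomial _ a, ← cfc_zero ℂ a]
      refine cfc_congr fun t ht => ?_
      exact Lagrange.eval_nodal_at_node (v := id) (by simp [ht])
    obtain ⟨q, hq⟩ := hdvd
    rw [mul_comm] at hq
    have e2 : aeval (v * a * star v) (q * X) = v * aeval a (q * X) * star v := by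
      rw [map_mul, aeval_X, map_mul, aeval_X, ← mul_assoc, ← mul_assoc, hint]
      simp only [mul_assoc]
    rw [hq, e2, ← hq, hzero, mul_zero, zero_mul]

end RangeProjection

end GroupoidOrbit

/-! ### Assembly of the theorem. -/

theorem mainTheorem11 {M : Type*} [CStarAlgebra M] [WStarAlgebra M]
    (a : M) (ha : IsStarNormal a) (hspec : (spectrum ℂ a).Finite) :
    (∃ N : Set M, N ⊆ GroupoidOrbit.sourceFiber a ∧
      N.PairwiseDisjoint (fun ν => GroupoidOrbit.unitaryOrbit (ν * a * star ν)) ∧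
      GroupoidOrbit.groupoidOrbit a =
        ⋃ ν ∈ N, GroupoidOrbit.unitaryOrbit (ν * a * star ν) ∧
      (∀ ν ∈ N, ∀ x ∈ GroupoidOrbit.unitaryOrbit (ν * a * star ν),
        connectedComponentIn (GroupoidOrbit.groupoidOrbit a) x =
          GroupoidOrbit.unitaryOrbit (ν * a * star ν)) ∧
      (∀ ν ∈ N, IsClopen
        (((↑) : GroupoidOrbit.groupoidOrbit a → M) ⁻¹'
          GroupoidOrbit.unitaryOrbit (ν * a * star ν)))) ∧
    IsClosed (GroupoidOrbit.groupoidOrbit a) ∧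
    GroupoidOrbit.IsEmbeddedSplitSubmanifold (GroupoidOrbit.groupoidOrbit a) := by
  open GroupoidOrbit Filter Topology in
  set Λ : Finset ℂ := insert 0 hspec.toFinset
  have hΛ : Λ.Nonempty := ⟨0, Finset.mem_insert_self _ _⟩
  have hsub : groupoidOrbit a ⊆ normalZeros M Λ := groupoidOrbit_subset_normalZeros ha hspec
  have hopen : ∀ b ∈ normalZeros M Λ, ∀ᶠ x in 𝓝 b, x ∈ normalZeros M Λ → x ∈ unitaryOrbit b := by
    intro b hb
    obtain ⟨r, -, h1, h2⟩ := exists_retraction_unitaryOrbit hΛ hb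
    filter_upwards [h1, h2] with x h1 h2 hx
    rw [← h2 hx]; exact h1
  have hopen' : ∀ b : M, IsOpen (((↑) : groupoidOrbit a → M) ⁻¹' unitaryOrbit b) := by
    intro b
    rw [isOpen_iff_mem_nhds]
    rintro ⟨x, hx⟩ hxb
    filter_upwards [continuous_subtype_val.continuousAt.eventually (hopen x (hsub hx))] with y hy
    exact mem_unitaryOrbit_trans hxb (hy (hsub y.2))
  have hclopen : ∀ b : M, IsClopen (((↑) : groupoidOrbit a → M) ⁻¹' unitaryOrbit b) := by
    intro b
    refine ⟨⟨?_⟩, hopen' b⟩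
    rw [isOpen_iff_mem_nhds]
    rintro ⟨x, hx⟩ hxb
    filter_upwards [(hopen' x).mem_nhds (mem_unitaryOrbit_self x)] with y hy hyb
    exact hxb (mem_unitaryOrbit_trans hyb (mem_unitaryOrbit_symm hy))
  refine ⟨?_, ?_, ?_⟩
  · let O : sourceFiber a → Set M := fun ν => unitaryOrbit ((ν : M) * a * star (ν : M))
    -- One representative per distinct orbit, so that the family is disjoint.
    choose s hs using fun o : Set.range O => o.2
    refine ⟨Set.range fun o => (s o : M), ?_, ?_, ?_, ?_, fun ν _ => hclopen _⟩
    · rintro _ ⟨o, rfl⟩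
      exact (s o).2
    · rintro _ ⟨o, rfl⟩ _ ⟨o', rfl⟩ hne
      refine disjoint_unitaryOrbit fun h => hne ?_
      have : o = o' := Subtype.ext ((hs o).symm.trans (h.trans (hs o')))
      rw [this]
    · apply Set.Subset.antisymm
      · rintro _ ⟨ν, hν, rfl⟩
        have h := hs ⟨O ⟨ν, hν⟩, ⟨ν, hν⟩, rfl⟩
        refine Set.mem_biUnion ⟨⟨O ⟨ν, hν⟩, ⟨ν, hν⟩, rfl⟩, rfl⟩ ?_
        change _ ∈ O _
        rw [h]
        exact mem_unitaryOrbit_self _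
      · refine Set.iUnion₂_subset ?_
        rintro _ ⟨o, rfl⟩
        exact unitaryOrbit_subset_groupoidOrbit ⟨_, (s o).2, rfl⟩
    · rintro _ ⟨o, rfl⟩ x hx
      have hOsub : unitaryOrbit ((s o : M) * a * star (s o : M)) ⊆ groupoidOrbit a :=
        unitaryOrbit_subset_groupoidOrbit ⟨_, (s o).2, rfl⟩
      apply Set.Subset.antisymm
      · rw [connectedComponentIn_eq_image (hOsub hx)]
        rintro _ ⟨y, hy, rfl⟩
        exact (hclopen _).connectedComponent_subset (x := ⟨x, hOsub hx⟩) hx hy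
      · exact (isPreconnected_unitaryOrbit _).subset_connectedComponentIn hx hOsub
  · refine isClosed_of_closure_subset fun b hb => ?_
    have hbQ : b ∈ normalZeros M Λ := closure_minimal hsub isClosed_normalZeros hb
    -- A limit point b is unitarily equivalent to some nearby x in O_a.
    obtain ⟨x, hx, hxO⟩ := mem_closure_iff_nhds.1 hb _ (hopen b hbQ)
    exact unitaryOrbit_subset_groupoidOrbit hxO (mem_unitaryOrbit_symm (hx (hsub hxO)))
  · refine isEmbeddedSplitSubmanifold_of_retract fun b hb => ?_
    obtain ⟨r, hr, h1, h2⟩ := exists_retraction_unitaryOrbit hΛ (hsub hb)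
    refine ⟨r, (hr.eventually (by simp)).mono fun x hx => hx.of_le (by simp), ?_, ?_⟩
    · filter_upwards [h1] with x hx using unitaryOrbit_subset_groupoidOrbit hb hx
    · filter_upwards [h2] with x hx hxO using hx (hsub hxO)
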